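/- Let $\sigma_{\mathrm{sig}}(z)=1/(1+e^{-z})$ and $\sigma_2(z)=z^2$. A network with $t\ge 1$ layers and activation $\sigma$ is a layered feed-forward network $F^{(1)}(\mathbf x)=W_1\mathbf x+\mathbf b_1$, $F^{(i)}(\mathbf x)=W_i\,\sigma(F^{(i-1)}(\mathbf x))+\mathbf b_i$ for $2\le i\le t$, with $\sigma$ applied coordinatewise, real weights $W_i$ and biases $\mathbf b_i$, and every layer nonempty; it implements the function $F^{(t)}:\mathbb R^d\to\mathbb R^s$. Its neurons are the coordinates of all layers $F^{(1)},\dots,F^{(t)}$ (output neurons are counted, inputs are not). Let $\mathcal N_{t,n,\sigma}$ be the class of functions implemented by networks with $t$ layers, $n$ neurons and activation $\sigma$, and let $\mathcal N_{t,n,\sigma,L}$ be the subclass obtained when the weight vector $\mathbf w$ and the bias $b$ of each neuron satisfy $\|\mathbf w\|_1+|b|\le L$. The input and output dimensions $d,s$ are arbitrary. **Theorem.** There are $\mathbb N$-valued functions $B_t=B_t(t,L,\epsilon)$ and $B_n=B_n(t,L,\epsilon)$ of an integer $t\ge1$ and reals $L\ge 3$, $0<\epsilon<1$, with $$B_t\in\tilde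 O\Big(\log\big(tL+L\log\tfrac1\epsilon\big)\Big),\qquad B_n\in\tilde O\Big(tL+L\log\tfrac1\epsilon\Big),$$ such that for all such $t,L,\epsilon$, all $d,s,n$, and every $f\in\mathcal N_{t,n,\sigma_{\mathrm{sig}},L}$ with $d$ inputs and $s$ outputs, there is a function $g\in\mathcal N_{tB_t,\,nB_n,\,\sigma_2}$ with the same $d$ and $s$ such that $$\sup_{\|\mathbf x\|_\infty<1}\|f(\mathbf x)-g(\mathbf x)\|_\infty\le\epsilon .$$ Here $B\in\tilde O(G)$ means that there are absolute constants $C\in\mathbb R$, $k\in\mathbb N$ such that $B\le C\,G\,(\log(2+G))^k$ for all $t\ge1$, $L\ge3$, $0<\epsilon<1$. -/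

import Mathlib

/-- Layered, fully connected feed-forward networks with `d` input coordinates and `s` output
neurons, every layer of which is nonempty. `output W b` is the network with a single layer
of `s` neurons, fed by the input; `layer N W b` feeds the activated neurons of the last layer of `N`
into a new last layer of `s` neurons. `W i` is the vector of input weights of the `i`-th
neuron of the last layer and `b i` is its bias. -/
inductive Network (d : ℕ) : ℕ → Type
  | output {s : ℕ} (hs : 0 < s) (W : Matrix (Fin s) (Fin d) ℝ) (b : Fin s → ℝ) : Network d s
  | layer {m s : ℕ} (N : Network d m) (hs : 0 < s) (W : Matrix (Fin s) (Fin m) ℝ)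
      (b : Fin s → ℝ) : Network d s

namespace Network

/-- The number of layers (the input is not counted as a layer, the output layer is). -/
def depth {d : ℕ} : {s : ℕ} → Network d s → ℕ
  | _, .output _ _ _ => 1
  | _, .layer N _ _ _ => N.depth + 1

/-- The number of neurons (input neurons are not counted, output neurons are). -/
def size {d : ℕ} : {s : ℕ} → Network d s → ℕ
  | s, .output _ _ _ => s
  | s, .layer N _ _ _ => N.size + s

/-- The function implemented by a network with activation function `σ`. The activation is applied
coordinatewise to every layer except the output layer, which is affine. -/
def eval {d : ℕ} (σ : ℝ → ℝ) : {s : ℕ} → Network d s → (Fin d → ℝ) → (Fin s → ℝ)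
  | _, .output _ W b, x => fun i => (∑ j, W i j * x j) + b i
  | _, .layer N _ W b, x => fun i => (∑ j, W i j * σ (N.eval σ x j)) + b i

/-- Every neuron (output neurons included) satisfies `‖w‖₁ + |b| ≤ L`. -/
def WeightsBounded {d : ℕ} (L : ℝ) : {s : ℕ} → Network d s → Prop
  | _, .output _ W b => ∀ i, (∑ j, |W i j|) + |b i| ≤ L
  | _, .layer N _ W b => N.WeightsBounded L ∧ ∀ i, (∑ j, |W i j|) + |b i| ≤ L

end Network

/-- `𝒩_{t,n,σ}` (with `d` inputs and `s` outputs): functions implemented by a network with `t` layers,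
`n` neurons, activation function `σ` and unrestricted weights. -/
def networkClass (d s t n : ℕ) (σ : ℝ → ℝ) : Set ((Fin d → ℝ) → (Fin s → ℝ)) :=
  {f | ∃ N : Network d s, N.depth = t ∧ N.size = n ∧ N.eval σ = f}

/-- `𝒩_{t,n,σ,L}`: as `networkClass`, with the input weights and bias of each neuron bounded
by `L` in the sense of `Network.WeightsBounded`. -/
def boundedNetworkClass (d s t n : ℕ) (σ : ℝ → ℝ) (L : ℝ) :
    Set ((Fin d → ℝ) → (Fin s → ℝ)) :=
  {f | ∃ N : Network d s, N.depth = t ∧ N.size = n ∧ N.WeightsBounded L ∧ N.eval σ = f}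

/-- The squared activation function. -/
def squareActivation (x : ℝ) : ℝ := x ^ 2

/-- `f ∈ Õ(g)`, uniformly on the set `D` of parameters: `f` is at most an absolute constant times
`g` times a fixed power of `log g` (with `2 + |g|` inside the logarithm, to keep it
positive). -/
def IsSoftO {α : Type*} (D : Set α) (f g : α → ℝ) : Prop :=
  ∃ C : ℝ, ∃ k : ℕ, ∀ p ∈ D, |f p| ≤ C * |g p| * Real.log (2 + |g p|) ^ k

/-- The admissible parameters `(t, L, ε)`: `t ≥ 1`, `L ≥ 3` and `0 < ε < 1`. -/
def approxParams : Set (ℕ × ℝ × ℝ) :=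
  {p | 1 ≤ p.1 ∧ 3 ≤ p.2.1 ∧ 0 < p.2.2 ∧ p.2.2 < 1}

/-! Each sigmoid is replaced by a polynomial, which a square-activated block evaluates exactly.

The poles of the sigmoid nearest the real axis are at distance `π`. Partial fractions express it
through terms `2z / (z² + a²)` with `a ≥ π`, and Chebyshev polynomials in `z²` approximate each term
on `|z| ≤ R` with error decaying like `(1 + π/R)^(-2m)`. So degree of order `R log(1/δ)` gives error
`δ` (`exists_polynomial_approx_sigmoid`).

Squaring yields products by polarization, so all powers up to `2 ^ K` cost `K` layers and `O(2 ^ K)`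
neurons (`Computes.powers`). Affine maps are absorbed into weights.

Sigmoid preactivations are at most `L` in absolute value, so `R = 2L` leaves room for errors up to
`1`. The sigmoid is `1/4`-Lipschitz, and a layer multiplies errors by at most `L`, so accuracy `δ =
ε / L ^ t` per activation suffices (`Network.exists_computes_approx`). This makes `2 ^ K` of order
`G log(2 + G)` with `G = tL + L log(1/ε)`. -/

/-! ### Partial fractions of the sigmoid -/

/-- The partial fraction expansion of the hyperbolic cotangent. -/
theorem hasSum_coth {y : ℝ} (hy : y ≠ 0) :
    HasSum (fun n : ℕ => 2 * y / (y ^ 2 + Real.pi ^ 2 * ((n : ℝ) + 1) ^ 2))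
      (Real.cosh y / Real.sinh y - 1 / y) := by
  have hpi : (Real.pi : ℂ) ≠ 0 := by exact_mod_cast Real.pi_ne_zero
  have hyc : (y : ℂ) ≠ 0 := by exact_mod_cast hy
  have hsinh : (Complex.sinh (y : ℂ)) ≠ 0 := by
    rw [← Complex.ofReal_sinh]; exact_mod_cast (Real.sinh_ne_zero.2 hy)
  -- The expansion of `π cot(πx)` at this imaginary point, multiplied by `I / π`, is that of `coth
  -- y`.
  set x : ℂ := (y / Real.pi : ℝ) * Complex.I with hxdef
  have hx : x ∈ Complex.integerComplement := by
    rw [Complex.mem_integerComplement_iff]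
    rintro ⟨n, hn⟩
    have := congrArg Complex.im hn
    simp only [Complex.intCast_im, hxdef, Complex.im_ofReal_mul, Complex.I_im,
      mul_one] at this
    exact div_ne_zero hy Real.pi_ne_zero this.symm
  have hs := (Summable.hasSum_iff_tendsto_nat (summable_cotTerm hx)).mpr
    (tendsto_logDeriv_euler_cot_sub hx)
  have hpx : (Real.pi : ℂ) * x = y * Complex.I := by
    rw [hxdef]; push_cast; field_simp
  have hs' := hs.mul_left (Complex.I / Real.pi)
  have hval : Complex.I / Real.pi * (Real.pi * Complex.cot (Real.pi * x) - 1 / x) =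
      ((Real.cosh y / Real.sinh y - 1 / y : ℝ) : ℂ) := by
    rw [hpx, Complex.cot, Complex.cos_mul_I, Complex.sin_mul_I, hxdef]
    push_cast
    field_simp
  rw [hval] at hs'
  rw [← Complex.hasSum_ofReal]
  refine (congrArg (HasSum · _) (funext fun n => ?_)).mpr hs'
  have hy2 : (y : ℂ) ^ 2 + Real.pi ^ 2 * (n + 1) ^ 2 ≠ 0 := by
    have : (0 : ℝ) < y ^ 2 + Real.pi ^ 2 * (n + 1) ^ 2 := by positivity
    exact_mod_cast this.ne'
  have hprod : (x + (n + 1)) * (x - (n + 1)) =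
      -((y : ℂ) ^ 2 + Real.pi ^ 2 * (n + 1) ^ 2) / Real.pi ^ 2 := by
    rw [hxdef]
    push_cast
    field_simp
    linear_combination (y : ℂ) ^ 2 * Complex.I_sq
  rw [cotTerm_identity hx, hprod, hxdef]
  push_cast
  field_simp
  linear_combination Complex.I_sq

/-- The left side `½ tanh(z/2)` equals `coth z - ½ coth(z/2)`, in which the two poles at `0` cancel.
-/
theorem hasSum_sigmoid (z : ℝ) :
    HasSum (fun n : ℕ => 2 * z / (z ^ 2 + (Real.pi * ((n : ℝ) + 1)) ^ 2) -
      2 * z / (z ^ 2 + (2 * Real.pi * ((n : ℝ) + 1)) ^ 2)) (Real.sigmoid z - 1 / 2) := by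
  rcases eq_or_ne z 0 with rfl | hz
  · simp
  have h1 := hasSum_coth hz
  have h2 := (hasSum_coth (y := z / 2) (by simpa using hz)).mul_left (1 / 2)
  have hv : Real.sigmoid z - 1 / 2 = (Real.cosh z / Real.sinh z - 1 / z) -
      1 / 2 * (Real.cosh (z / 2) / Real.sinh (z / 2) - 1 / (z / 2)) := by
    have hs : Real.sinh (z / 2) ≠ 0 := Real.sinh_ne_zero.2 (by simpa using hz)
    have hc : Real.cosh (z / 2) ≠ 0 := (Real.cosh_pos _).ne'
    have e1 : Real.cosh z = Real.cosh (z / 2) ^ 2 + Real.sinh (z / 2) ^ 2 := by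
      rw [← Real.cosh_two_mul]; ring_nf
    have e2 : Real.sinh z = 2 * Real.sinh (z / 2) * Real.cosh (z / 2) := by
      rw [← Real.sinh_two_mul]; ring_nf
    have e3 : Real.sigmoid z = Real.exp (z / 2) / (2 * Real.cosh (z / 2)) := by
      rw [Real.sigmoid_def, Real.cosh_eq, inv_eq_one_div, div_eq_div_iff (by positivity) (by positivity)]
      have : Real.exp (-z) = Real.exp (-(z / 2)) * Real.exp (-(z / 2)) := by
        rw [← Real.exp_add]; ring_nf
      have h' : Real.exp (z / 2) * Real.exp (-(z / 2)) = 1 := by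
        rw [← Real.exp_add]; simp
      rw [this]
      linear_combination (-Real.exp (-(z / 2))) * h'
    have e4 := Real.cosh_add_sinh (z / 2)
    have e5 := Real.cosh_sq (z / 2)
    rw [e3, e1, e2, ← e4]
    field_simp
    ring
  rw [hv]
  refine (congrArg (HasSum · _) (funext fun n => ?_)).mpr (h1.sub h2)
  have e : (z / 2) ^ 2 + Real.pi ^ 2 * ((n : ℝ) + 1) ^ 2 =
      (z ^ 2 + (2 * Real.pi * ((n : ℝ) + 1)) ^ 2) / 4 := by ring
  rw [e, mul_pow]
  field_simp
  ring

/-! ### Chebyshev approximation -/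

-- Uses `T_m(cosh θ) = cosh(mθ)` with `θ = 2 arsinh h`. The base `1 + h` is linear in `h`, which
-- later makes the degree linear, not quadratic, in `L`.
open Polynomial in
theorem one_add_pow_le_eval_chebyshev (m : ℕ) {h : ℝ} (hh : 0 ≤ h) :
    (1 + h) ^ (2 * m) / 2 ≤ (Chebyshev.T ℝ m).eval (1 + 2 * h ^ 2) := by
  have hc : 1 + 2 * h ^ 2 = Real.cosh (2 * Real.arsinh h) := by
    rw [Real.cosh_two_mul, Real.cosh_sq, Real.sinh_arsinh]; ring
  have hexp : 1 + h ≤ Real.exp (Real.arsinh h) := by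
    rw [Real.exp_arsinh]
    have : 1 ≤ √(1 + h ^ 2) := Real.one_le_sqrt.2 (by nlinarith)
    linarith
  rw [hc, Chebyshev.T_real_cosh, Real.cosh_eq]
  have : (1 + h) ^ (2 * m) ≤ Real.exp (((m : ℤ) : ℝ) * (2 * Real.arsinh h)) := by
    calc (1 + h) ^ (2 * m) ≤ Real.exp (Real.arsinh h) ^ (2 * m) := by gcongr
      _ = _ := by rw [← Real.exp_nat_mul]; push_cast; ring_nf
  have h2 := Real.exp_pos (-(((m : ℤ) : ℝ) * (2 * Real.arsinh h)))
  linarith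

-- Let `Q` be `T_m` after the affine map taking `[0, R²]` onto `[-1, 1]`. Then `1 - Q / Q(-a²)`
-- vanishes at `-a²`; its quotient by `X + a²` differs from `1 / (z² + a²)` by `Q(z²) / (Q(-a²) (z²
-- + a²))`.
open Polynomial in
theorem exists_polynomial_approx_inv_sq_add_sq {R a B : ℝ} {m : ℕ} (hm : 0 < m) (hR : 0 < R)
    (ha : 0 < a) (hB : 0 < B) (hBa : B ≤ (Chebyshev.T ℝ m).eval (1 + 2 * (a / R) ^ 2)) :
    ∃ p : ℝ[X], p.natDegree < m ∧
      ∀ z : ℝ, |z| ≤ R → |1 / (z ^ 2 + a ^ 2) - p.eval (z ^ 2)| ≤ 1 / (a ^ 2 * B) := by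
  set Q : ℝ[X] := (Chebyshev.T ℝ m).comp (1 - C (2 / R ^ 2) * X) with hQ
  set q := (Chebyshev.T ℝ m).eval (1 + 2 * (a / R) ^ 2) with hq
  have hq0 : 0 < q := hB.trans_le hBa
  have hQa : Q.eval (-a ^ 2) = q := by
    rw [hQ, hq, eval_comp]
    congr 1
    simp
    ring
  set S : ℝ[X] := 1 - C (1 / q) * Q with hS
  have hroot : S.IsRoot (-a ^ 2) := by
    simp [hS, IsRoot, hQa, hq0.ne']
  have hdiv := mul_divByMonic_eq_iff_isRoot.2 hroot
  refine ⟨S /ₘ (X - C (-a ^ 2)), ?_, fun z hz => ?_⟩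
  · rw [natDegree_divByMonic _ (monic_X_sub_C _), natDegree_X_sub_C]
    have hQd : Q.natDegree ≤ m := by
      rw [hQ, natDegree_comp, Chebyshev.natDegree_T]
      have : (1 - C (2 / R ^ 2) * X : ℝ[X]).natDegree ≤ 1 := by compute_degree
      simpa using Nat.mul_le_mul_left m this
    have : S.natDegree ≤ m := by
      refine (natDegree_sub_le _ _).trans (max_le (by simp) ((natDegree_C_mul_le _ _).trans hQd))
    omega
  · have hz2 : z ^ 2 ≤ R ^ 2 := sq_le_sq' (by linarith [neg_abs_le z]) ((le_abs_self z).trans hz)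
    have hpos : 0 < z ^ 2 + a ^ 2 := by positivity
    have hev : (z ^ 2 + a ^ 2) * (S /ₘ (X - C (-a ^ 2))).eval (z ^ 2) = 1 - 1 / q * Q.eval (z ^ 2) := by
      have := congrArg (eval (z ^ 2)) hdiv
      rw [eval_mul] at this
      simpa [hS] using this
    have hQz : |Q.eval (z ^ 2)| ≤ 1 := by
      rw [hQ, eval_comp]
      apply Chebyshev.abs_eval_T_real_le_one
      have h1 : 0 ≤ 2 / R ^ 2 * z ^ 2 := by positivity
      have h2 : 2 / R ^ 2 * z ^ 2 ≤ 2 := by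
        rw [div_mul_eq_mul_div, div_le_iff₀ (by positivity)]; linarith
      simp only [eval_sub, eval_one, eval_mul, eval_C, eval_X]
      rw [abs_le]; constructor <;> linarith
    have : 1 / (z ^ 2 + a ^ 2) - (S /ₘ (X - C (-a ^ 2))).eval (z ^ 2) =
        Q.eval (z ^ 2) / (q * (z ^ 2 + a ^ 2)) := by
      have h3 : (S /ₘ (X - C (-a ^ 2))).eval (z ^ 2) =
          (1 - 1 / q * Q.eval (z ^ 2)) / (z ^ 2 + a ^ 2) := by
        rw [← hev]; field_simp
      rw [h3]; field_simp; ring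
    rw [this, abs_div, abs_of_pos (by positivity : 0 < q * (z ^ 2 + a ^ 2)), mul_comm (a ^ 2)]
    have : 0 ≤ z ^ 2 := sq_nonneg z
    gcongr
    linarith

open Polynomial in
theorem exists_polynomial_approx_sigmoid {R : ℝ} (hR : 0 < R) {m : ℕ} (hm : 0 < m) :
    ∃ P : ℝ[X], P.natDegree < 2 * m ∧
      ∀ z : ℝ, |z| ≤ R → |Real.sigmoid z - P.eval z| ≤ 2 * R / (1 + Real.pi / R) ^ (2 * m) := by
  have hpi := Real.pi_pos
  set A : ℝ := (1 + Real.pi / R) ^ (2 * m) with hA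
  have hA0 : 0 < A := by positivity
  have key (a : ℝ) (ha : Real.pi ≤ a) := exists_polynomial_approx_inv_sq_add_sq (R := R) (a := a)
    (B := A / 2) hm hR (hpi.trans_le ha) (by positivity)
    (le_trans (by rw [hA]; gcongr) (one_add_pow_le_eval_chebyshev m (h := a / R)
      (div_nonneg (hpi.trans_le ha).le hR.le)))
  have hge (n : ℕ) : Real.pi ≤ Real.pi * ((n : ℝ) + 1) :=
    le_mul_of_one_le_right hpi.le (by linarith [n.cast_nonneg (α := ℝ)])
  have hge' (n : ℕ) : Real.pi ≤ 2 * Real.pi * ((n : ℝ) + 1) := by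
    linarith [hge n]
  choose p hpd hp using fun n : ℕ => key _ (hge n)
  choose p' hpd' hp' using fun n : ℕ => key _ (hge' n)
  have hzeta : HasSum (fun n : ℕ => 1 / ((n : ℝ) + 1) ^ 2) (Real.pi ^ 2 / 6) := by
    have := (hasSum_nat_add_iff' 1).2 hasSum_zeta_two
    simpa using this
  have htail : TendstoUniformlyOn (fun N z => ∑ n ∈ Finset.range N,
      (2 * z / (z ^ 2 + (Real.pi * ((n : ℝ) + 1)) ^ 2) -
        2 * z / (z ^ 2 + (2 * Real.pi * ((n : ℝ) + 1)) ^ 2)))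
      (fun z => ∑' n : ℕ, (2 * z / (z ^ 2 + (Real.pi * ((n : ℝ) + 1)) ^ 2) -
        2 * z / (z ^ 2 + (2 * Real.pi * ((n : ℝ) + 1)) ^ 2))) Filter.atTop {z | |z| ≤ R} := by
    refine tendstoUniformlyOn_tsum_nat (u := fun n => 4 * R * (1 / ((n : ℝ) + 1) ^ 2))
      (hzeta.summable.mul_left _) fun n z (hz : |z| ≤ R) => ?_
    have bd (a : ℝ) (ha : (n : ℝ) + 1 ≤ a) :
        |2 * z / (z ^ 2 + a ^ 2)| ≤ 2 * R * (1 / ((n : ℝ) + 1) ^ 2) := by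
      have : (0 : ℝ) < n + 1 := by positivity
      rw [abs_div, abs_mul, abs_two, abs_of_nonneg (by positivity : 0 ≤ z ^ 2 + a ^ 2),
        mul_one_div]
      gcongr
      nlinarith [sq_nonneg z]
    have h0 := n.cast_nonneg (α := ℝ)
    have h3 := Real.pi_gt_three
    calc _ ≤ _ := abs_sub _ _
      _ ≤ 2 * R * (1 / ((n : ℝ) + 1) ^ 2) + 2 * R * (1 / ((n : ℝ) + 1) ^ 2) :=
        add_le_add (bd _ (by nlinarith)) (bd _ (by nlinarith))
      _ = _ := by ring
  -- The error budget `2R / A` is split: `R / A` for truncating the series, `R / A` for the finitely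
  -- many remaining terms, whose errors sum by `ζ(2) = π²/6`.
  obtain ⟨N, hN⟩ := (Metric.tendstoUniformlyOn_iff.1 htail (R / A) (by positivity)).exists
  refine ⟨C (1 / 2) + ∑ n ∈ Finset.range N,
    C 2 * X * ((p n).comp (X ^ 2) - (p' n).comp (X ^ 2)), ?_, fun z hz => ?_⟩
  · have hcomp (r : ℝ[X]) (hr : r.natDegree < m) :
        (r.comp (X ^ 2)).natDegree ≤ 2 * m - 2 := by
      rw [natDegree_comp, natDegree_X_pow]; omega
    have : (C (1 / 2) + ∑ n ∈ Finset.range N,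
        C 2 * X * ((p n).comp (X ^ 2) - (p' n).comp (X ^ 2)) : ℝ[X]).natDegree ≤ 2 * m - 1 := by
      refine (natDegree_add_le _ _).trans (max_le (by simp) ?_)
      refine natDegree_sum_le_of_forall_le _ _ fun n _ => ?_
      refine natDegree_mul_le.trans ?_
      have h1 : (C 2 * X : ℝ[X]).natDegree ≤ 1 := by compute_degree
      have h2 := natDegree_sub_le ((p n).comp (X ^ 2)) ((p' n).comp (X ^ 2))
      have h3 := hcomp _ (hpd n)
      have h4 := hcomp _ (hpd' n)
      omega
    omega
  · have h1 := hN z hz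
    rw [(hasSum_sigmoid z).tsum_eq, Real.dist_eq] at h1
    have hterm (n : ℕ) : |2 * z / (z ^ 2 + (Real.pi * ((n : ℝ) + 1)) ^ 2) -
        2 * z / (z ^ 2 + (2 * Real.pi * ((n : ℝ) + 1)) ^ 2) -
        2 * z * ((p n).eval (z ^ 2) - (p' n).eval (z ^ 2))| ≤
        5 * R / (Real.pi ^ 2 * A) * (1 / ((n : ℝ) + 1) ^ 2) := by
      have e : 2 * z / (z ^ 2 + (Real.pi * ((n : ℝ) + 1)) ^ 2) -
          2 * z / (z ^ 2 + (2 * Real.pi * ((n : ℝ) + 1)) ^ 2) -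
          2 * z * ((p n).eval (z ^ 2) - (p' n).eval (z ^ 2)) =
          2 * z * ((1 / (z ^ 2 + (Real.pi * ((n : ℝ) + 1)) ^ 2) - (p n).eval (z ^ 2)) -
          (1 / (z ^ 2 + (2 * Real.pi * ((n : ℝ) + 1)) ^ 2) - (p' n).eval (z ^ 2))) := by ring
      rw [e, abs_mul, abs_mul, abs_two]
      calc _ ≤ 2 * R * (1 / ((Real.pi * ((n : ℝ) + 1)) ^ 2 * (A / 2)) +
            1 / ((2 * Real.pi * ((n : ℝ) + 1)) ^ 2 * (A / 2))) := by
            gcongr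
            exact (abs_sub _ _).trans (add_le_add (hp n z hz) (hp' n z hz))
        _ = _ := by field_simp; ring
    have hsum : |∑ n ∈ Finset.range N, (2 * z / (z ^ 2 + (Real.pi * ((n : ℝ) + 1)) ^ 2) -
        2 * z / (z ^ 2 + (2 * Real.pi * ((n : ℝ) + 1)) ^ 2)) -
        ∑ n ∈ Finset.range N, 2 * z * ((p n).eval (z ^ 2) - (p' n).eval (z ^ 2))| ≤ R / A := by
      rw [← Finset.sum_sub_distrib]
      calc _ ≤ ∑ n ∈ Finset.range N, 5 * R / (Real.pi ^ 2 * A) * (1 / ((n : ℝ) + 1) ^ 2) :=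
            (Finset.abs_sum_le_sum_abs _ _).trans (Finset.sum_le_sum fun n _ => hterm n)
        _ = 5 * R / (Real.pi ^ 2 * A) * ∑ n ∈ Finset.range N, (1 / ((n : ℝ) + 1) ^ 2) := by
            rw [Finset.mul_sum]
        _ ≤ 5 * R / (Real.pi ^ 2 * A) * (Real.pi ^ 2 / 6) := by
            gcongr
            exact sum_le_hasSum _ (fun n _ => by positivity) hzeta
        _ = 5 / 6 * (R / A) := by field_simp
        _ ≤ R / A := by linarith [div_pos hR hA0]
    have hev : (C (1 / 2) + ∑ n ∈ Finset.range N,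
        C 2 * X * ((p n).comp (X ^ 2) - (p' n).comp (X ^ 2)) : ℝ[X]).eval z =
        1 / 2 + ∑ n ∈ Finset.range N, 2 * z * ((p n).eval (z ^ 2) - (p' n).eval (z ^ 2)) := by
      simp [eval_finsetSum]
    rw [hev, mul_div_assoc, two_mul (R / A)]
    refine le_trans (le_of_eq ?_) ((abs_add_le _ _).trans (add_le_add h1.le hsum))
    congr 1
    ring

/-! ### Arithmetic with square-activated networks -/

/-- An affine map can be absorbed by the output layer. -/
theorem Network.exists_eval_eq_affine {d c s : ℕ} (N : Network d c) (hs : 0 < s) (σ : ℝ → ℝ)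
    (V : Fin s → Fin c → ℝ) (a : Fin s → ℝ) :
    ∃ N' : Network d s, N'.depth = N.depth ∧ N'.size + c = N.size + s ∧
      ∀ x i, N'.eval σ x i = (∑ j, V i j * N.eval σ x j) + a i := by
  have key {m : ℕ} (W : Matrix (Fin c) (Fin m) ℝ) (b : Fin c → ℝ) (y : Fin m → ℝ) (i : Fin s) :
      (∑ l, (∑ j, V i j * W j l) * y l) + ((∑ j, V i j * b j) + a i) =
        (∑ j, V i j * ((∑ l, W j l * y l) + b j)) + a i := by
    simp only [mul_add, Finset.sum_add_distrib, Finset.sum_mul, Finset.mul_sum]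
    rw [Finset.sum_comm, add_assoc]
    simp only [mul_assoc]
  cases N with
  | output hc W b =>
    exact ⟨.output hs (fun i l => ∑ j, V i j * W j l) (fun i => (∑ j, V i j * b j) + a i), rfl,
      add_comm _ _, fun x i => key W b x i⟩
  | layer N hc W b =>
    exact ⟨.layer N hs (fun i l => ∑ j, V i j * W j l) (fun i => (∑ j, V i j * b j) + a i), rfl,
      by simp only [Network.size]; ring, fun x i => key W b (fun l => σ (N.eval σ x l)) i⟩

/-- `Computes F k H`: with squared activation, some network of depth `k` with at most `H` neurons
below its output layer has the coordinates of `F` as its output neurons. -/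
def Computes {d : ℕ} {ι : Type} [Fintype ι] (F : (Fin d → ℝ) → ι → ℝ) (k H : ℕ) : Prop :=
  ∃ N : Network d (Fintype.card ι), N.depth = k ∧ N.size ≤ H + Fintype.card ι ∧
    ∀ x i, N.eval squareActivation x (Fintype.equivFin ι i) = F x i

namespace Computes

variable {d : ℕ} {ι κ : Type} [Fintype ι] [Fintype κ]

theorem mono {F : (Fin d → ℝ) → ι → ℝ} {k H H' : ℕ} (h : Computes F k H) (hH : H ≤ H') :
    Computes F k H' := by
  obtain ⟨N, h1, h2, h3⟩ := h
  exact ⟨N, h1, h2.trans (by omega), h3⟩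

theorem input [Nonempty ι] (W : ι → Fin d → ℝ) (b : ι → ℝ) :
    Computes (fun x i => (∑ j, W i j * x j) + b i) 1 0 := by
  refine ⟨.output Fintype.card_pos (fun i j => W ((Fintype.equivFin ι).symm i) j)
    (fun i => b ((Fintype.equivFin ι).symm i)), rfl, by simp [Network.size], fun x i => ?_⟩
  simp [Network.eval]

theorem affine [Nonempty κ] {F : (Fin d → ℝ) → ι → ℝ} {k H : ℕ} (h : Computes F k H)
    (W : κ → ι → ℝ) (b : κ → ℝ) :
    Computes (fun x j => (∑ i, W j i * F x i) + b j) k H := by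
  obtain ⟨N, hd, hs, hF⟩ := h
  obtain ⟨N', h1, h2, h3⟩ := N.exists_eval_eq_affine (Fintype.card_pos (α := κ)) squareActivation
    (fun j i => W ((Fintype.equivFin κ).symm j) ((Fintype.equivFin ι).symm i))
    (fun j => b ((Fintype.equivFin κ).symm j))
  refine ⟨N', h1.trans hd, by omega, fun x j => ?_⟩
  rw [h3, ← (Fintype.equivFin ι).sum_comp]
  simp [hF]

theorem square_affine [Nonempty κ] {F : (Fin d → ℝ) → ι → ℝ} {k H : ℕ} (h : Computes F k H)
    (W : κ → ι → ℝ) (b : κ → ℝ) :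
    Computes (fun x j => (∑ i, W j i * F x i ^ 2) + b j) (k + 1) (H + Fintype.card ι) := by
  obtain ⟨N, hd, hs, hF⟩ := h
  refine ⟨.layer N Fintype.card_pos
    (fun j i => W ((Fintype.equivFin κ).symm j) ((Fintype.equivFin ι).symm i))
    (fun j => b ((Fintype.equivFin κ).symm j)), by simp [Network.depth, hd],
    by simpa [Network.size] using hs, fun x j => ?_⟩
  simp only [Network.eval, Equiv.symm_apply_apply, ← hF, squareActivation]
  rw [← (Fintype.equivFin ι).sum_comp]
  simp

/-- Polarization: `uv = ((u + v)² - (u - v)²) / 4`, two squares per product. -/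
theorem mul [Nonempty κ] {F : (Fin d → ℝ) → ι → ℝ} {k H : ℕ}
    (h : Computes F k H) (a b : κ → ι) :
    Computes (fun x j => F x (a j) * F x (b j)) (k + 1) (H + 2 * Fintype.card κ) := by
  classical
  have h1 := h.affine (κ := κ ⊕ κ)
    (Sum.elim (fun j => Pi.single (a j) 1 + Pi.single (b j) 1)
      (fun j => Pi.single (a j) 1 - Pi.single (b j) 1)) 0
  have h2 := h1.square_affine (κ := κ)
    (fun j => Sum.elim (Pi.single j (1 / 4)) (Pi.single j (-1 / 4))) 0
  convert h2 using 1
  · funext x j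
    simp [Pi.single_apply, add_mul, sub_mul, Finset.sum_add_distrib, Finset.sum_sub_distrib]
    ring
  · simp; ring

theorem powers [Nonempty ι] {F : (Fin d → ℝ) → ι → ℝ} {k H : ℕ} (h : Computes F k H) (j : ℕ) :
    Computes (fun x (p : ι × Fin (2 ^ j + 1)) => F x p.1 ^ (p.2 : ℕ)) (k + j)
      (H + Fintype.card ι * (8 * 2 ^ j)) := by
  classical
  -- This sharper count is preserved exactly by the induction: doubling adds `2 (2 ^ (j + 1) + 1)`
  -- neurons per coordinate.
  suffices Computes (fun x (p : ι × Fin (2 ^ j + 1)) => F x p.1 ^ (p.2 : ℕ)) (k + j)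
      (H + Fintype.card ι * (4 * 2 ^ j + 2 * j)) by
    refine this.mono ?_
    have := j.lt_two_pow_self
    gcongr
    omega
  induction j with
  | zero =>
    have h1 := h.affine (κ := ι × Fin (2 ^ 0 + 1))
      (fun p => if p.2 = 0 then 0 else Pi.single p.1 1) (fun p => if p.2 = 0 then 1 else 0)
    convert h1.mono (Nat.le_add_right _ _) using 1
    · funext x ⟨i, e⟩
      fin_cases e <;> simp [Pi.single_apply]
    · rfl
  | succ j ih =>
    -- Each exponent `e ≤ 2 ^ (j + 1)` splits as `min e (2 ^ j)` plus a remainder at most `2 ^ j`.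
    have h1 := ih.mul (κ := ι × Fin (2 ^ (j + 1) + 1))
      (fun p => (p.1, ⟨min p.2 (2 ^ j), Nat.lt_succ_of_le (min_le_right _ _)⟩))
      (fun p => (p.1, ⟨p.2 - min (p.2 : ℕ) (2 ^ j), by
        have h1 := p.2.2
        have h2 := pow_succ 2 j
        omega⟩))
    have h2 : (fun x (p : ι × Fin (2 ^ (j + 1) + 1)) => F x p.1 ^ (p.2 : ℕ)) = fun x p =>
        F x p.1 ^ min (p.2 : ℕ) (2 ^ j) * F x p.1 ^ ((p.2 : ℕ) - min (p.2 : ℕ) (2 ^ j)) := by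
      funext x p
      rw [← pow_add]
      congr 1
      omega
    rw [h2]
    refine h1.mono (le_of_eq ?_)
    rw [Fintype.card_prod, Fintype.card_fin]
    ring

open Polynomial in
theorem polynomial_affine [Nonempty ι] [Nonempty κ] {F : (Fin d → ℝ) → ι → ℝ} {k H : ℕ}
    (h : Computes F k H) (j : ℕ) (P : ℝ[X]) (hP : P.natDegree ≤ 2 ^ j) (W : κ → ι → ℝ)
    (b : κ → ℝ) :
    Computes (fun x l => (∑ i, W l i * P.eval (F x i)) + b l) (k + j)
      (H + Fintype.card ι * (8 * 2 ^ j)) := by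
  convert (h.powers j).affine (κ := κ) (fun l p => W l p.1 * P.coeff p.2) b using 1
  funext x l
  congr 1
  rw [Fintype.sum_prod_type]
  refine Finset.sum_congr rfl fun i _ => ?_
  rw [eval_eq_sum_range' (Nat.lt_succ_of_le hP), Finset.mul_sum, Finset.sum_range]
  exact Finset.sum_congr rfl fun e _ => by ring

end Computes

/-- Neurons with zero weights can be added below the output layer. -/
theorem Network.exists_size_eq {d s : ℕ} (N : Network d s) (hd : 2 ≤ N.depth) {n : ℕ}
    (hn : N.size ≤ n) (σ : ℝ → ℝ) :
    ∃ N' : Network d s, N'.depth = N.depth ∧ N'.size = n ∧ N'.eval σ = N.eval σ := by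
  obtain ⟨p, rfl⟩ := Nat.exists_eq_add_of_le hn
  cases N with
  | output hs W b => simp [Network.depth] at hd
  | @layer m s N hs W b =>
    obtain ⟨N', h1, h2, h3⟩ : ∃ N' : Network d (m + p), N'.depth = N.depth ∧
        N'.size = N.size + p ∧ ∀ x i, N'.eval σ x (Fin.castAdd p i) = N.eval σ x i := by
      cases N with
      | output hs W b =>
        exact ⟨.output (by omega) (Fin.append (fun i => W i) 0) (Fin.append b 0), rfl, rfl,
          fun x i => by
            simp only [Network.eval]
            rw [Fin.append_left, Fin.append_left]⟩
      | layer N hs W b =>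
        exact ⟨.layer N (by omega) (Fin.append (fun i => W i) 0) (Fin.append b 0), rfl,
          by simp [Network.size, add_assoc], fun x i => by
            simp only [Network.eval]
            rw [Fin.append_left, Fin.append_left]⟩
    refine ⟨.layer N' hs (fun i => Fin.append (W i) 0) b, by simp [Network.depth, h1], ?_, ?_⟩
    · simp [Network.size, h2]; ring
    · funext x i
      simp [Network.eval, Fin.sum_univ_add, h3]

/-! ### Layer-by-layer replacement and error propagation -/

theorem abs_sigmoid_sub_sigmoid_le (a b : ℝ) :
    |Real.sigmoid a - Real.sigmoid b| ≤ 1 / 4 * |a - b| := by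
  refine Convex.norm_image_sub_le_of_norm_deriv_le (f := Real.sigmoid) (s := Set.univ)
    (fun x _ => differentiable_sigmoid x) (fun x _ => ?_) convex_univ trivial trivial
  have h0 := Real.sigmoid_pos x
  have h1 := Real.sigmoid_lt_one x
  rw [Real.deriv_sigmoid, Real.norm_eq_abs, abs_of_nonneg (by nlinarith)]
  nlinarith [sq_nonneg (Real.sigmoid x - 1 / 2)]

theorem abs_sum_mul_le_of_abs_le {m : ℕ} (w y : Fin m → ℝ) {e : ℝ} (hy : ∀ j, |y j| ≤ e) :
    |∑ j, w j * y j| ≤ (∑ j, |w j|) * e := by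
  rw [Finset.sum_mul]
  refine (Finset.abs_sum_le_sum_abs _ _).trans (Finset.sum_le_sum fun j _ => ?_)
  rw [abs_mul]
  exact mul_le_mul_of_nonneg_left (hy j) (abs_nonneg _)

theorem Network.abs_eval_sigmoid_le {d s : ℕ} {N : Network d s} {L : ℝ}
    (hN : N.WeightsBounded L) {x : Fin d → ℝ} (hx : ‖x‖ < 1) (i : Fin s) :
    |N.eval Real.sigmoid x i| ≤ L := by
  have key {m : ℕ} (w y : Fin m → ℝ) (b : ℝ) (hw : (∑ j, |w j|) + |b| ≤ L)
      (hy : ∀ j, |y j| ≤ 1) : |(∑ j, w j * y j) + b| ≤ L := by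
    have := abs_sum_mul_le_of_abs_le w y hy
    linarith [abs_add_le (∑ j, w j * y j) b]
  cases N with
  | output hs W b => exact key _ _ _ (hN i) fun j => (norm_le_pi_norm x j).trans hx.le
  | layer N hs W b =>
    refine key _ _ _ (hN.2 i) fun j => ?_
    rw [abs_of_nonneg (Real.sigmoid_nonneg _)]
    exact Real.sigmoid_le_one _

-- An old error `e = δ L ^ k` becomes at most `L (δ + e / 4) ≤ δ L ^ (k + 1)`, as `L ≥ 3`. In the
-- size bound, the reserve `s * (8 * 2 ^ K)` pays for the powers of the current outputs when the
-- next layer is added.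
open Polynomial in
theorem Network.exists_computes_approx {d s : ℕ} (N : Network d s) {L δ : ℝ} (hL : 3 ≤ L)
    (hδ : 0 < δ) {P : ℝ[X]} {K : ℕ} (hK : 1 ≤ K) (hP : P.natDegree ≤ 2 ^ K)
    (hPσ : ∀ z : ℝ, |z| ≤ 2 * L → |Real.sigmoid z - P.eval z| ≤ δ)
    (hN : N.WeightsBounded L) (hδL : δ * L ^ N.depth ≤ 1) :
    ∃ (F : (Fin d → ℝ) → Fin s → ℝ) (H : ℕ), Computes F (N.depth * K) H ∧
      H + s * (8 * 2 ^ K) ≤ N.size * (16 * 2 ^ K) ∧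
      ∀ x, ‖x‖ < 1 → ∀ i, |N.eval Real.sigmoid x i - F x i| ≤ δ * L ^ N.depth := by
  classical
  induction N with
  | @output s hs W b =>
    have : NeZero s := ⟨hs.ne'⟩
    -- The first layer has no activation below it; evaluating the identity polynomial stretches its
    -- depth from `1` to `K`.
    have h1 := (Computes.input (d := d) W b).polynomial_affine (κ := Fin s) (K - 1) X
      (natDegree_X_le.trans Nat.one_le_two_pow) (fun i => Pi.single i 1) 0
    refine ⟨_, _, by convert h1 using 1; simp only [Network.depth]; omega, ?_, fun x _ i => ?_⟩
    · have : 2 ^ (K - 1) ≤ 2 ^ K := Nat.pow_le_pow_right (by norm_num) (by omega)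
      rw [Fintype.card_fin]
      simp only [Network.size]
      nlinarith
    · have : 0 ≤ δ * L ^ (Network.output hs W b).depth := by positivity
      simpa [Network.eval, Pi.single_apply] using this
  | @layer m s N hs W b ih =>
    have : NeZero s := ⟨hs.ne'⟩
    have hm : NeZero m := ⟨by cases N <;> omega⟩
    have hle : δ * L ^ N.depth ≤ δ * L ^ (N.depth + 1) := by
      gcongr
      · linarith
      · omega
    have hδ1 : δ * L ^ N.depth ≤ 1 := hle.trans hδL
    obtain ⟨F, H, hF, hH, hFx⟩ := ih hN.1 hδ1
    refine ⟨_, _, by convert hF.polynomial_affine (κ := Fin s) K P hP W b using 1;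
                     simp only [Network.depth]; ring, ?_, fun x hx i => ?_⟩
    · rw [Fintype.card_fin]
      simp only [Network.size]
      nlinarith
    · have hy (j : Fin m) : |Real.sigmoid (N.eval Real.sigmoid x j) - P.eval (F x j)| ≤
          δ + 1 / 4 * (δ * L ^ N.depth) := by
        have h1 := hFx x hx j
        have h2 := Network.abs_eval_sigmoid_le hN.1 hx j
        have h3 := abs_sigmoid_sub_sigmoid_le (N.eval Real.sigmoid x j) (F x j)
        have h4 := hPσ (F x j) (by
          have := abs_sub_abs_le_abs_sub (F x j) (N.eval Real.sigmoid x j)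
          rw [abs_sub_comm] at this
          linarith)
        linarith [abs_sub_le (Real.sigmoid (N.eval Real.sigmoid x j)) (Real.sigmoid (F x j))
          (P.eval (F x j))]
      have h5 := abs_sum_mul_le_of_abs_le (W i) _ hy
      have h6 : ∑ j, |W i j| ≤ L := by linarith [hN.2 i, abs_nonneg (b i)]
      have h7 : 1 ≤ N.depth := by cases N <;> simp [Network.depth]
      have h8 : δ * L ≤ δ * L ^ N.depth := by
        gcongr
        exact le_self_pow₀ (by linarith) (by omega)
      have e : (Network.layer N hs W b).eval Real.sigmoid x i -
          ((∑ j, W i j * P.eval (F x j)) + b i) =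
          ∑ j, W i j * (Real.sigmoid (N.eval Real.sigmoid x j) - P.eval (F x j)) := by
        simp only [Network.eval, mul_sub, Finset.sum_sub_distrib]
        ring
      have h9 : 0 ≤ δ + 1 / 4 * (δ * L ^ N.depth) := by positivity
      rw [e]
      calc _ ≤ L * (δ + 1 / 4 * (δ * L ^ N.depth)) :=
            h5.trans (mul_le_mul_of_nonneg_right h6 h9)
        _ ≤ δ * L ^ (N.depth + 1) := by
            rw [pow_succ, ← mul_assoc]
            have : 0 ≤ δ * L ^ N.depth := by positivity
            nlinarith [mul_le_mul_of_nonneg_right hL this]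

/-! ### Choice of parameters and conclusion -/

/-- The quantity `tL + L log(1/ε)`. -/
noncomputable def accuracyScale (p : ℕ × ℝ × ℝ) : ℝ :=
  (p.1 : ℝ) * p.2.1 + p.2.1 * Real.log (1 / p.2.2)

/-- The number of layers that replace one layer. -/
noncomputable def blockDepth (p : ℕ × ℝ × ℝ) : ℕ :=
  Nat.clog 2 ⌈4 * (accuracyScale p * Real.log (2 + accuracyScale p))⌉₊

theorem le_accuracyScale {p : ℕ × ℝ × ℝ} (hp : p ∈ approxParams) :
    p.2.1 ≤ accuracyScale p ∧ 3 ≤ accuracyScale p := by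
  obtain ⟨ht, hL, h0, h1⟩ := hp
  have ht' : (1 : ℝ) ≤ p.1 := by exact_mod_cast ht
  have hlog : 0 ≤ Real.log (1 / p.2.2) := Real.log_nonneg (by rw [le_div_iff₀ h0]; linarith)
  unfold accuracyScale
  constructor <;> nlinarith

theorem one_le_log_of_three_le {x : ℝ} (hx : 3 ≤ x) : 1 ≤ Real.log x := by
  rw [Real.le_log_iff_exp_le (by linarith)]
  linarith [Real.exp_one_lt_d9]

theorem two_pow_blockDepth_bounds {p : ℕ × ℝ × ℝ} (hp : p ∈ approxParams) :
    4 * (accuracyScale p * Real.log (2 + accuracyScale p)) ≤ 2 ^ blockDepth p ∧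
    (2 : ℝ) ^ blockDepth p ≤ 16 * (accuracyScale p * Real.log (2 + accuracyScale p)) ∧
    2 ≤ blockDepth p := by
  have hG := (le_accuracyScale hp).2
  have hlog := one_le_log_of_three_le (x := 2 + accuracyScale p) (by linarith)
  set Y := accuracyScale p * Real.log (2 + accuracyScale p) with hY
  have hY3 : 3 ≤ Y := by nlinarith
  have h12 : 12 ≤ ⌈4 * Y⌉₊ := by
    have : (12 : ℝ) ≤ ⌈4 * Y⌉₊ := le_trans (by linarith) (Nat.le_ceil _)
    exact_mod_cast this
  have hlow : ⌈4 * Y⌉₊ ≤ 2 ^ blockDepth p := Nat.le_pow_clog (by norm_num) _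
  have hup : 2 ^ (blockDepth p).pred < ⌈4 * Y⌉₊ := 
    Nat.pow_pred_clog_lt_self (by norm_num) (by rw [← hY]; omega)
  have h2 : 2 ≤ blockDepth p := by
    by_contra! h
    have := Nat.pow_le_pow_right (n := 2) (by norm_num) (Nat.lt_succ_iff.1 h)
    omega
  refine ⟨(Nat.le_ceil _).trans (by exact_mod_cast hlow), ?_, h2⟩
  have hup' : (2 : ℝ) ^ (blockDepth p).pred < 4 * Y + 1 :=
    lt_trans (by exact_mod_cast hup) (Nat.ceil_lt_add_one (by linarith))
  have : (2 : ℝ) ^ blockDepth p = 2 * 2 ^ (blockDepth p).pred := by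
    rw [← pow_succ', Nat.pred_eq_sub_one, Nat.sub_add_cancel (by omega)]
  linarith

theorem blockDepth_le {p : ℕ × ℝ × ℝ} (hp : p ∈ approxParams) :
    (blockDepth p : ℝ) ≤ 12 * Real.log (accuracyScale p) := by
  have hG := (le_accuracyScale hp).2
  set G := accuracyScale p
  have h1 : Real.log (2 + G) ≤ G ^ 2 := by
    nlinarith [Real.log_le_sub_one_of_pos (by linarith : 0 < 2 + G)]
  have h2 : (2 : ℝ) ^ blockDepth p ≤ G ^ 6 := by
    calc _ ≤ 16 * (G * Real.log (2 + G)) := (two_pow_blockDepth_bounds hp).2.1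
      _ ≤ G ^ 3 * (G * G ^ 2) := by
          have : (3 : ℝ) ^ 3 ≤ G ^ 3 := by gcongr
          have : 0 ≤ Real.log (2 + G) := Real.log_nonneg (by linarith)
          gcongr
          linarith
      _ = G ^ 6 := by ring
  have h3 := Real.log_le_log (by positivity) h2
  rw [Real.log_pow, Real.log_pow] at h3
  have h4 := Real.log_two_gt_d9
  have h5 : (0 : ℝ) ≤ blockDepth p := Nat.cast_nonneg _
  push_cast at h3
  nlinarith

/-- The sigmoid approximation with `R = 2L` and `2m = 2 ^ K` reaches accuracy `ε / L ^ t`. After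
taking logarithms, it suffices that `2 ^ K / L` dominates `log 4 + (t + 1) log L + log(1/ε)`. -/
theorem four_mul_div_pow_le {t : ℕ} {L ε : ℝ} (hp : (t, L, ε) ∈ approxParams) :
    2 * (2 * L) / (1 + Real.pi / (2 * L)) ^ 2 ^ blockDepth (t, L, ε) ≤ ε / L ^ t := by
  obtain ⟨hLG, hG⟩ := le_accuracyScale hp
  obtain ⟨ht, hL, h0, h1⟩ := id hp
  dsimp only at hLG ht hL h0 h1
  have hlow := (two_pow_blockDepth_bounds hp).1
  set G := accuracyScale (t, L, ε) with hGdef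
  set K := blockDepth (t, L, ε)
  have hpi := Real.pi_gt_three
  have hbase : 1 / L ≤ Real.log (1 + Real.pi / (2 * L)) := by
    refine le_trans ?_ (Real.one_sub_inv_le_log_of_pos (by positivity))
    have : 1 - (1 + Real.pi / (2 * L))⁻¹ = Real.pi / (2 * L + Real.pi) := by
      field_simp
      ring
    rw [this, div_le_div_iff₀ (by positivity) (by positivity)]
    nlinarith
  have ht' : (1 : ℝ) ≤ t := by exact_mod_cast ht
  set l := Real.log (1 / ε) with hl
  have hl0 : 0 ≤ l := Real.log_nonneg (by rw [le_div_iff₀ h0]; linarith)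
  set Λ := Real.log (2 + G) with hΛ
  have hΛ1 : 1 ≤ Λ := one_le_log_of_three_le (by linarith)
  have hlogL : Real.log L ≤ Λ := Real.log_le_log (by linarith) (by linarith)
  have hlog4 : Real.log 4 ≤ 2 := by
    rw [show (4 : ℝ) = 2 ^ 2 by norm_num, Real.log_pow]
    have := Real.log_two_lt_d9
    push_cast
    linarith
  have hmain : Real.log (4 * L ^ (t + 1) * (1 / ε)) ≤
      (2 ^ K : ℕ) * Real.log (1 + Real.pi / (2 * L)) := by
    rw [Real.log_mul (by positivity) (by positivity), Real.log_mul (by positivity) (by positivity),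
      Real.log_pow]
    push_cast
    have hGL : G = L * (t + l) := by rw [hGdef, accuracyScale]; ring
    calc Real.log 4 + (t + 1) * Real.log L + l ≤ 2 * t * Λ + 2 * t * Λ + l * Λ := by
          have : Real.log 4 ≤ 2 * t * Λ := by nlinarith
          have : (t + 1) * Real.log L ≤ 2 * t * Λ :=
            mul_le_mul (by linarith) hlogL (Real.log_nonneg (by linarith)) (by linarith)
          have : l ≤ l * Λ := le_mul_of_one_le_right hl0 hΛ1
          linarith
      _ ≤ 4 * (G * Λ) * (1 / L) := by
          rw [hGL]
          field_simp
          nlinarith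
      _ ≤ _ := by gcongr
  rw [← Real.log_pow, Real.log_le_log_iff (by positivity) (by positivity)] at hmain
  rw [div_le_div_iff₀ (by positivity) (by positivity)]
  calc 2 * (2 * L) * L ^ t = ε * (4 * L ^ (t + 1) * (1 / ε)) := by field_simp; ring
    _ ≤ _ := by gcongr

theorem mainTheorem1 :
    ∃ Bt Bn : ℕ × ℝ × ℝ → ℕ,
      IsSoftO approxParams (fun p => (Bt p : ℝ))
        (fun (t, L, ε) => Real.log ((t : ℝ) * L + L * Real.log (1 / ε))) ∧
      IsSoftO approxParams (fun p => (Bn p : ℝ))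
        (fun (t, L, ε) => (t : ℝ) * L + L * Real.log (1 / ε)) ∧
      ∀ (t : ℕ) (L ε : ℝ), (t, L, ε) ∈ approxParams →
        ∀ (d s n : ℕ), ∀ f ∈ boundedNetworkClass d s t n Real.sigmoid L,
          ∃ g ∈ networkClass d s (t * Bt (t, L, ε)) (n * Bn (t, L, ε)) squareActivation,
            ∀ x : Fin d → ℝ, ‖x‖ < 1 → ‖f x - g x‖ ≤ ε := by
  -- Here `272 = 17 * 16`, with `16` from the upper bound on `2 ^ blockDepth p`.
  refine ⟨blockDepth, fun p => 17 * 2 ^ blockDepth p, ⟨12, 0, ?_⟩, ⟨272, 1, ?_⟩, ?_⟩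
  · rintro p hp
    have h := blockDepth_le hp
    rw [Nat.abs_cast, pow_zero, mul_one]
    exact h.trans (by gcongr; exact le_abs_self _)
  · rintro p hp
    have h := (two_pow_blockDepth_bounds hp).2.1
    have hG := (le_accuracyScale hp).2
    change |_| ≤ 272 * |accuracyScale p| * Real.log (2 + |accuracyScale p|) ^ 1
    rw [Nat.abs_cast, abs_of_nonneg (by linarith : 0 ≤ accuracyScale p)]
    push_cast
    linarith
  · rintro t L ε hp d s n f ⟨N, hNt, hNn, hNL, rfl⟩
    obtain ⟨ht, hL, h0, h1⟩ := id hp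
    dsimp only at ht hL h0 h1
    have hK := (two_pow_blockDepth_bounds hp).2.2
    have herr := four_mul_div_pow_le hp
    set K := blockDepth (t, L, ε)
    obtain ⟨P, hPd, hPσ⟩ := exists_polynomial_approx_sigmoid (R := 2 * L) (by linarith)
      (m := 2 ^ (K - 1)) (by positivity)
    rw [← pow_succ', Nat.sub_add_cancel (by omega)] at hPd hPσ
    have hε : ε / L ^ t * L ^ N.depth = ε := by
      rw [hNt]; field_simp
    obtain ⟨F, H, ⟨M, hMd, hMs, hMF⟩, hH, hF⟩ := N.exists_computes_approx hL (δ := ε / L ^ t)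
      (by positivity) (by omega) hPd.le (fun z hz => (hPσ z hz).trans herr) hNL (by linarith)
    have hs : 0 < s := by cases N <;> assumption
    obtain ⟨M', hMd', hMs', hMF'⟩ := M.exists_eval_eq_affine hs squareActivation
      (fun i => Pi.single (Fintype.equivFin (Fin s) i) 1) 0
    have hMF'' (x : Fin d → ℝ) (i : Fin s) : M'.eval squareActivation x i = F x i := by
      rw [hMF', ← hMF]
      simp [Pi.single_apply]
    have hdep : M'.depth = t * K := by rw [hMd', hMd, hNt]
    -- The class fixes the exact neuron count, so the last hidden layer is padded; one exists
    -- because `t * K ≥ 2`.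
    obtain ⟨M'', hd'', hs'', he''⟩ := M'.exists_size_eq (n := n * (17 * 2 ^ K))
      (by rw [hdep]; nlinarith) (by
        rw [hNn] at hH
        have : s ≤ s * (8 * 2 ^ K) := Nat.le_mul_of_pos_right s (by positivity)
        have : n * (16 * 2 ^ K) ≤ n * (17 * 2 ^ K) := by gcongr; norm_num
        omega) squareActivation
    refine ⟨_, ⟨M'', hd''.trans hdep, hs'', rfl⟩, fun x hx => ?_⟩
    rw [pi_norm_le_iff_of_nonneg h0.le, he'']
    intro i
    rw [Pi.sub_apply, hMF'', Real.norm_eq_abs]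
    exact (hF x hx i).trans_eq hε
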